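/- Let $\mathbb{F}_q$ be a finite field with $q$ elements, let $n\ge 1$, let $Q=\mathbb{F}_q[x_1,\dots,x_n]/(x_1^{q^2},\dots,x_n^{q^2})$, and let $G=GL_n(\mathbb{F}_q)$ act on $Q$ by invertible linear substitutions of the variables. Let $Q^G$ be the ring of invariants, graded by polynomial degree, and let $Hilb(Q^G,t)=\sum_{d\ge 0}\dim_{\mathbb{F}_q}(Q^G)_d\,t^d$. For $0\le k\le q$ put $$y_{n,k}=\sum_{\substack{i_1+\dots+i_n=(n-1)q+k\\ 0\le i_1,\dots,i_n\le q}}\ \prod_{j=1}^n x_j^{i_j(q-1)},\qquad z_n=\prod_{j=1}^n x_j^{q^2-1}.$$ (1) If $n\ge 2$, then $$Hilb(Q^G,t)=1+t^{(n-1)(q^2-q)}\left(1+t^{q-1}+t^{2(q-1)}+\dots+t^{q^2-q}\right)+t^{n(q^2-1)},$$ and the classes in $Q$ of the $q+3$ polynomials $1$, $y_{n,0},\dots,y_{n,q}$, $z_n$ form an $\mathbb{F}_q$-basis of $Q^G$. (2) If $n=1$, then $$Hilb(Q^G,t)=\frac{1-t^{q^2+q-2}}{1-t^{q-1}},$$ and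 the classes of the $q+2$ polynomials $y_{1,0}=1$, $y_{1,1},\dots,y_{1,q}$, $z_1$ form an $\mathbb{F}_q$-basis of $Q^G$. (3) Consequently, for every $n\ge 1$ the Lewis–Reiner–Stanton formula holds for $m=2$: $$Hilb(Q^G,t)=\sum_{k=0}^{\min(n,2)}t^{(n-k)(q^2-q^k)}\prod_{i=0}^{k-1}\frac{1-t^{q^2-q^i}}{1-t^{q^k-q^i}}.$$ -/

import Mathlib

namespace FrobInv

open MvPolynomial

section

variable {F : Type*} [Field F] {n : ℕ}

/-- The linear substitution `x_j ↦ ∑ i, g i j • x_i` on polynomials. -/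
noncomputable def linSubst (g : Matrix (Fin n) (Fin n) F) :
    MvPolynomial (Fin n) F →ₐ[F] MvPolynomial (Fin n) F :=
  aeval fun j => ∑ i, C (g i j) * X i

theorem linSubst_one : linSubst (1 : Matrix (Fin n) (Fin n) F) = AlgHom.id F _ := by
  ext j : 1
  simp [linSubst, Matrix.one_apply]

theorem linSubst_mul (g h : Matrix (Fin n) (Fin n) F) :
    linSubst (g * h) = (linSubst g).comp (linSubst h) := by
  ext j : 1
  simp only [linSubst, aeval_X, AlgHom.comp_apply, map_sum, map_mul, Matrix.mul_apply,
    ← algebraMap_eq, AlgHom.commutes, Finset.sum_mul, Finset.mul_sum]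
  rw [Finset.sum_comm]
  refine Finset.sum_congr rfl fun i _ => Finset.sum_congr rfl fun k _ => ?_
  ring

variable [Fintype F] (F n) (m : ℕ)

/-- The Frobenius power `(x_1^{q^m}, …, x_n^{q^m})`, where `q = |F|`. -/
noncomputable def frobIdeal : Ideal (MvPolynomial (Fin n) F) :=
  Ideal.span (Set.range fun i : Fin n => (X i : MvPolynomial (Fin n) F) ^ (Fintype.card F ^ m))

/-- The truncated polynomial ring `Q = F[x_1, …, x_n] / (x_1^{q^m}, …, x_n^{q^m})`. -/
abbrev Q : Type _ := MvPolynomial (Fin n) F ⧸ frobIdeal F n m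

variable {F n}

/-- Linear substitutions preserve the Frobenius power, so they act on the quotient. -/
theorem frobIdeal_le_comap (g : Matrix (Fin n) (Fin n) F) :
    frobIdeal F n m ≤ (frobIdeal F n m).comap (linSubst g) := by
  refine Ideal.span_le.2 ?_
  rintro _ ⟨j, rfl⟩
  obtain ⟨p, hp⟩ := CharP.exists F
  obtain ⟨k, hprime, hk⟩ := FiniteField.card F p
  have : Fact p.Prime := ⟨hprime⟩
  simp only [SetLike.mem_coe, Ideal.mem_comap, map_pow, linSubst, aeval_X]
  rw [hk, ← pow_mul, sum_pow_char_pow, ← Ideal.Quotient.eq_zero_iff_mem, map_sum]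
  refine Finset.sum_eq_zero fun i _ => Ideal.Quotient.eq_zero_iff_mem.2 ?_
  rw [mul_pow]
  refine Ideal.mul_mem_left _ _ (Ideal.subset_span ⟨i, ?_⟩)
  simp only [hk, ← pow_mul]

variable (F n)

/-- The action of `GL_n(F)` on `Q` by linear substitution of the variables. -/
noncomputable def action : GL (Fin n) F →* (Q F n m →ₐ[F] Q F n m) where
  toFun g := Ideal.quotientMapₐ (frobIdeal F n m) (linSubst (g : Matrix (Fin n) (Fin n) F))
    (frobIdeal_le_comap m _)
  map_one' := by
    refine Ideal.Quotient.algHom_ext _ (AlgHom.ext fun f => ?_)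
    simp [linSubst_one]
  map_mul' g h := by
    refine Ideal.Quotient.algHom_ext _ (AlgHom.ext fun f => ?_)
    simp [linSubst_mul]

/-- The invariant ring `Q^G` for `G = GL_n(F)`. -/
noncomputable def invariants : Subalgebra F (Q F n m) :=
  ⨅ g : GL (Fin n) F, AlgHom.equalizer (action F n m g) (AlgHom.id F (Q F n m))

theorem mem_invariants (f : Q F n m) :
    f ∈ invariants F n m ↔ ∀ g : GL (Fin n) F, action F n m g f = f := by
  simp [invariants, Algebra.mem_iInf]

/-- The degree `d` part of `Q`: the classes of homogeneous polynomials of degree `d`. -/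
noncomputable def degreePart (d : ℕ) : Submodule F (Q F n m) :=
  (homogeneousSubmodule (Fin n) F d).map (Ideal.Quotient.mkₐ F (frobIdeal F n m)).toLinearMap

/-- The Hilbert series `∑ d, dim (Q^G)_d t^d`. -/
noncomputable def hilbertSeries : PowerSeries ℚ :=
  PowerSeries.mk fun d =>
    (Module.finrank F ↥(Subalgebra.toSubmodule (invariants F n m) ⊓ degreePart F n m d) : ℚ)

/-- The `(q,t)`-binomial `∏_{i<k} (1 - t^{q^m - q^i}) / (1 - t^{q^k - q^i})`, as a power series;
for `2 ≤ q` all the denominators are units. -/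
noncomputable def qtBinom (q m k : ℕ) : PowerSeries ℚ :=
  ∏ i ∈ Finset.range k, ((1 - PowerSeries.X ^ (q ^ m - q ^ i)) *
    (1 - PowerSeries.X ^ (q ^ k - q ^ i))⁻¹)

/-- The series conjectured by Lewis, Reiner and Stanton to be the Hilbert series of `Q^G`. -/
noncomputable def lrsSeries (q n m : ℕ) : PowerSeries ℚ :=
  ∑ k ∈ Finset.range (min n m + 1),
    PowerSeries.X ^ ((n - k) * (q ^ m - q ^ k)) * qtBinom q m k

/-- The polynomial `y_{n,k}`: the sum of `∏ j, x_j^{i_j (q-1)}` over all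
`0 ≤ i_1, …, i_n ≤ q` with `i_1 + … + i_n = (n-1) q + k`. -/
noncomputable def yPoly (k : ℕ) : MvPolynomial (Fin n) F :=
  ∑ i : Fin n → Fin (Fintype.card F + 1) with
      ∑ j, (i j : ℕ) = (n - 1) * Fintype.card F + k,
    ∏ j, X j ^ ((i j : ℕ) * (Fintype.card F - 1))

/-- The polynomial `z_n = ∏ j, x_j^{q^2-1}`. -/
noncomputable def zPoly : MvPolynomial (Fin n) F :=
  ∏ j, X j ^ (Fintype.card F ^ 2 - 1)

end

end FrobInv

/-!
Diagonal matrices force the exponents of an invariant to be multiples of `q - 1`, so an invariant is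
`R(x_1 ^ (q - 1), …, x_n ^ (q - 1))` for a unique `R` with exponents at most `q + 1`. The other
generators of `GL_n` are the transvections `x_a ↦ x_a + c x_b`. These only mix monomials which
agree in the remaining variables and have the same total degree in `x_a` and `x_b`. Setting
`x_b = 1`, invariance becomes a condition on one-variable polynomials `f`, one for each such class
of monomials: a shift of the variable must not change the coefficients of `f(X ^ (q - 1))`, apart
from those killed by `x_a ^ (q ^ 2)` or `x_b ^ (q ^ 2)`. Comparing well chosen coefficients, where
the binomial coefficient is a unit by Lucas' theorem, gives three facts on the monomials of `R`:
* if one exponent is `q + 1`, then so are all the others;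
* two exponents of a nonconstant monomial have sum at least `q`;
* moving degree from one variable to another does not change the coefficient, as long as all
  exponents stay at most `q`.

Hence `R` is determined by its coefficients at the exponents `0`, `(k, q, …, q)` and
`(q + 1, …, q + 1)`. The polynomials `1`, `y_{n,k}` and `z_n` are dual to these coefficients.
-/

namespace FrobInv

section OneVariable

open Polynomial

theorem coeff_taylor_of_natDegree_le {R : Type*} [CommSemiring R] (c : R) {g : R[X]} {u : ℕ}
    (hg : g.natDegree ≤ u) : (taylor c g).coeff u = g.coeff u := by
  rcases hg.eq_or_lt with rfl | hlt
  · exact coeff_taylor_natDegree c g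
  · rw [coeff_eq_zero_of_natDegree_lt hlt,
      coeff_eq_zero_of_natDegree_lt ((natDegree_taylor g c).trans_lt hlt)]

theorem natDegree_taylor_X_pow_succ_sub_le {R : Type*} [CommRing R] (c : R) (m : ℕ) :
    (taylor c (X ^ (m + 1) : R[X]) - X ^ (m + 1)).natDegree ≤ m := by
  refine natDegree_le_iff_coeff_eq_zero.2 fun u hu => ?_
  rw [coeff_sub, coeff_taylor_of_natDegree_le c ((natDegree_X_pow_le _).trans hu), sub_self]

theorem coeff_taylor_one_of_natDegree_eraseLead_le {R : Type*} [CommRing R] {g : R[X]} {u : ℕ}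
    (hg : g.eraseLead.natDegree ≤ u) (hu : u < g.natDegree) :
    (taylor 1 g).coeff u = g.coeff u + g.leadingCoeff * (g.natDegree.choose u : R) := by
  have hlead : (taylor 1 (monomial g.natDegree g.leadingCoeff)).coeff u =
      g.leadingCoeff * (g.natDegree.choose u : R) := by
    rw [taylor_monomial, C_1, coeff_C_mul, coeff_X_add_one_pow]
  conv_lhs => rw [← g.eraseLead_add_monomial_natDegree_leadingCoeff]
  rw [map_add, coeff_add, hlead, coeff_taylor_of_natDegree_le 1 hg,
    eraseLead_coeff_of_ne u hu.ne]

theorem eraseLead_expand {R : Type*} [CommRing R] {p : ℕ} (hp : 0 < p) (h : R[X]) :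
    (expand R p h).eraseLead = expand R p h.eraseLead := by
  rw [← self_sub_monomial_natDegree_leadingCoeff, ← self_sub_monomial_natDegree_leadingCoeff,
    map_sub, expand_monomial, natDegree_expand, leadingCoeff_expand hp]

variable {F : Type*} [Field F] [Fintype F]

local notation "q" => Fintype.card F

variable (F) in
theorem card_mul_card_sub_one_add_card : q * (q - 1) + q = q ^ 2 := by
  rw [← Nat.mul_succ, Nat.succ_eq_add_one, Nat.sub_add_cancel Fintype.card_pos, pow_two]

variable (F) in
theorem mul_card_sub_one_lt_card_sq_iff {r : ℕ} : r * (q - 1) < q ^ 2 ↔ r ≤ q + 1 := by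
  have hq : 0 < q - 1 := Nat.sub_pos_of_lt Fintype.one_lt_card
  have hmax := Nat.sq_sub_sq q 1
  have hsq := card_mul_card_sub_one_add_card F
  refine ⟨fun h => ?_, fun h => ?_⟩
  · by_contra! hr
    have := Nat.mul_le_mul_right (q - 1) hr
    rw [Nat.succ_mul] at this
    omega
  · have := Nat.mul_le_mul_right (q - 1) h
    omega

theorem add_pow_card {A : Type*} [CommRing A] [Algebra F A] (x y : A) :
    (x + y) ^ q = x ^ q + y ^ q :=
  map_add (FiniteField.frobeniusAlgHom F A) x y

theorem cast_choose_mul_card_add_eq_one (j : ℕ) {r : ℕ} (hr : r < q) :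
    (((j * q + r).choose (j * q) : ℕ) : F) = 1 := by
  obtain ⟨w, hw⟩ : (X ^ q : F[X]) ∣ (X ^ q + 1) ^ j - 1 := by
    simpa only [one_pow, add_sub_cancel_right] using sub_dvd_pow_sub_pow ((X : F[X]) ^ q + 1) 1 j
  have hsplit : (X + 1 : F[X]) ^ (j * q + r) = X ^ q * (w * (X + 1) ^ r) + (X + 1) ^ r := by
    rw [pow_add, mul_comm j, pow_mul, add_pow_card, one_pow, eq_add_of_sub_eq hw]
    ring
  rw [Nat.choose_symm_add, ← coeff_X_add_one_pow, hsplit, coeff_add, coeff_X_pow_mul',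
    if_neg hr.not_ge, zero_add, coeff_X_add_one_pow, Nat.choose_self, Nat.cast_one]

variable (F) in
/-- The polynomials `h` for which the part of degree `s (q - 1)` of `R(x ^ (q - 1), y ^ (q - 1))`,
where `R(x, y)` is the form of degree `s` with `R(x, 1) = h`, is invariant under all the
substitutions `x ↦ x + c y` modulo `x ^ q²` and `y ^ q²`. Here `u` and `v` are the exponents of
`x` and `y`. -/
noncomputable def pairInvariants (s : ℕ) :
    Submodule F F[X] where
  carrier := {h | ∀ c : F, ∀ u v, u < q ^ 2 → v < q ^ 2 → u + v = s * (q - 1) →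
    (taylor c (expand F (q - 1) h)).coeff u = (expand F (q - 1) h).coeff u}
  add_mem' hg hh c u v hu hv huv := by
    simp only [map_add, coeff_add, hg c u v hu hv huv, hh c u v hu hv huv]
  zero_mem' c u v _ _ _ := by simp only [map_zero]
  smul_mem' r h hh c u v hu hv huv := by
    simp only [map_smul, coeff_smul, hh c u v hu hv huv]

variable (F) in
/-- The sum `X ^ k + ⋯ + X ^ q`, which is what the generator `y_{n,k'}` looks like in any two of
the variables when the remaining exponents are fixed. -/
noncomputable def geomBlock (k : ℕ) : F[X] :=
  ∑ r ∈ Finset.Ico k (q + 1), X ^ r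

theorem coeff_geomBlock (k r : ℕ) :
    (geomBlock F k).coeff r = if k ≤ r ∧ r ≤ q then 1 else 0 := by
  simp only [geomBlock, finsetSum_coeff, coeff_X_pow, Finset.sum_ite_eq, Finset.mem_Ico,
    Nat.lt_succ_iff]

theorem natDegree_geomBlock_le (k : ℕ) : (geomBlock F k).natDegree ≤ q :=
  natDegree_le_iff_coeff_eq_zero.2 fun r hr => by
    rw [coeff_geomBlock, if_neg fun h => hr.not_ge h.2]

theorem X_pow_card_sub_X_mul_expand_geomBlock {k : ℕ} (hk : k ≤ q) :
    (X ^ q - X) * expand F (q - 1) (geomBlock F k) = X ^ q ^ 2 - X ^ (k * (q - 1) + 1) := by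
  obtain ⟨p, hp⟩ : ∃ p, q = p + 1 := ⟨q - 1, (Nat.sub_add_cancel Fintype.card_pos).symm⟩
  have hgeom := geom_sum_Ico_mul ((X : F[X]) ^ p) (m := k) (n := q + 1) (by omega)
  simp only [geomBlock, map_sum, map_pow, expand_X, hp, Nat.add_sub_cancel] at hgeom ⊢
  linear_combination X * hgeom

theorem taylor_X_pow_card_sub_X (c : F) : taylor c (X ^ q - X : F[X]) = X ^ q - X := by
  rw [map_sub, taylor_X_pow, taylor_X, add_pow_card, ← C_pow, FiniteField.pow_card,
    add_sub_add_right_eq_sub]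

theorem taylor_X_pow_card_sq (c : F) : taylor c (X ^ q ^ 2 : F[X]) = X ^ q ^ 2 + C c := by
  rw [taylor_X_pow, pow_two, pow_mul, add_pow_card, add_pow_card, ← C_pow, ← C_pow,
    FiniteField.pow_card, FiniteField.pow_card, ← pow_mul]

theorem natDegree_taylor_expand_geomBlock_sub_add_card_le {k : ℕ} (hk : k ≤ q) (c : F)
    (hne : taylor c (expand F (q - 1) (geomBlock F k)) ≠ expand F (q - 1) (geomBlock F k)) :
    (taylor c (expand F (q - 1) (geomBlock F k)) - expand F (q - 1) (geomBlock F k)).natDegree + q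
      ≤ k * (q - 1) := by
  set h := expand F (q - 1) (geomBlock F k)
  have hmul := X_pow_card_sub_X_mul_expand_geomBlock hk
  have hdiff : (X ^ q - X) * (taylor c h - h) =
      C c - (taylor c (X ^ (k * (q - 1) + 1)) - X ^ (k * (q - 1) + 1)) := by
    have htaylor := congrArg (taylor c) hmul
    rw [taylor_mul, taylor_X_pow_card_sub_X, map_sub, taylor_X_pow_card_sq] at htaylor
    linear_combination htaylor - hmul
  rw [add_comm]
  nth_rw 1 [← FiniteField.X_pow_card_sub_X_natDegree_eq F Fintype.one_lt_card]
  rw [← natDegree_mul (FiniteField.X_pow_card_sub_X_ne_zero F Fintype.one_lt_card)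
      (sub_ne_zero.2 hne), hdiff]
  exact (natDegree_sub_le _ _).trans
    (max_le ((natDegree_C c).trans_le (Nat.zero_le _)) (natDegree_taylor_X_pow_succ_sub_le c _))

theorem geomBlock_mem_pairInvariants {k : ℕ} (hk : k ≤ q) :
    geomBlock F k ∈ pairInvariants F (q + k) := by
  intro c u v _ hv huv
  rw [← sub_eq_zero, ← coeff_sub]
  by_cases hne : taylor c (expand F (q - 1) (geomBlock F k)) = expand F (q - 1) (geomBlock F k)
  · rw [hne, sub_self, coeff_zero]
  refine coeff_eq_zero_of_natDegree_lt ?_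
  have hdeg := natDegree_taylor_expand_geomBlock_sub_add_card_le hk c hne
  have := card_mul_card_sub_one_add_card F
  rw [add_mul] at huv
  omega

theorem X_pow_card_add_one_mem_pairInvariants :
    (X ^ (q + 1) : F[X]) ∈ pairInvariants F (2 * q + 2) := by
  intro c u v hu hv huv
  have := Nat.sq_sub_sq q 1
  have hu' : u = (q + 1) * (q - 1) := by
    rw [show 2 * q + 2 = 2 * (q + 1) by ring, mul_assoc] at huv
    omega
  refine coeff_taylor_of_natDegree_le c ?_
  rw [natDegree_expand, natDegree_X_pow, hu']

theorem coeff_taylor_expand_ne {h : F[X]} (h0 : h ≠ 0) {j r : ℕ} (hr0 : 0 < r) (hrq : r < q)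
    (hdeg : h.natDegree * (q - 1) = j * q + r) (hlow : (h.natDegree - 1) * (q - 1) ≤ j * q) :
    (taylor 1 (expand F (q - 1) h)).coeff (j * q) ≠ (expand F (q - 1) h).coeff (j * q) := by
  have hq : 0 < q - 1 := Nat.sub_pos_of_lt Fintype.one_lt_card
  have herase : (expand F (q - 1) h).eraseLead.natDegree ≤ j * q := by
    rw [eraseLead_expand hq, natDegree_expand]
    exact (Nat.mul_le_mul_right _ h.eraseLead_natDegree_le).trans hlow
  rw [coeff_taylor_one_of_natDegree_eraseLead_le herase (by rw [natDegree_expand]; omega),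
    natDegree_expand, hdeg, cast_choose_mul_card_add_eq_one j hrq, mul_one,
    leadingCoeff_expand hq, Ne, add_eq_left, leadingCoeff_eq_zero]
  exact h0

theorem natDegree_eq_zero_of_mem_pairInvariants {s : ℕ} {h : F[X]} (hh : h ∈ pairInvariants F s)
    (hdq : h.natDegree < q) (hds : h.natDegree ≤ s) (hsd : s ≤ q + h.natDegree) :
    h.natDegree = 0 := by
  by_contra hd
  obtain ⟨j, hj⟩ := Nat.exists_eq_add_one_of_ne_zero hd
  obtain ⟨r, hr⟩ := Nat.exists_eq_add_of_lt hdq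
  have hdeg : h.natDegree * (q - 1) = j * q + (r + 1) := by
    rw [hr, hj, Nat.add_sub_cancel]; ring
  have hu : j * q ≤ s * (q - 1) := by
    have := Nat.mul_le_mul_right (q - 1) hds
    omega
  have hv : s * (q - 1) < q ^ 2 + j * q := by
    have := Nat.mul_le_mul_right (q - 1) hsd
    rw [add_mul, hdeg] at this
    have := card_mul_card_sub_one_add_card F
    omega
  refine coeff_taylor_expand_ne (ne_zero_of_natDegree_gt (Nat.pos_of_ne_zero hd)) r.succ_pos
    (by omega) hdeg ?_ (hh 1 (j * q) (s * (q - 1) - j * q) ?_ (by omega) (by omega))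
  · rw [hj, Nat.add_sub_cancel]
    exact Nat.mul_le_mul_left j (Nat.sub_le _ _)
  · rw [pow_two]
    exact Nat.mul_lt_mul_of_pos_right (by omega) Fintype.card_pos

theorem coeff_card_add_one_eq_zero_of_mem_pairInvariants {s : ℕ} {h : F[X]}
    (hh : h ∈ pairInvariants F s) (hdeg : h.natDegree ≤ q + 1) (hqs : q ≤ s)
    (hs : s ≤ 2 * q + 1) : h.coeff (q + 1) = 0 := by
  by_contra hne
  have hd : h.natDegree = q + 1 := hdeg.antisymm (le_natDegree_of_ne_zero hne)
  obtain ⟨p, hp⟩ : ∃ p, q = p + 1 := Nat.exists_eq_add_one_of_ne_zero Fintype.card_ne_zero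
  have hp0 : 0 < p := by have := Fintype.one_lt_card (α := F); omega
  have hu : p * q ≤ s * p := mul_comm p q ▸ Nat.mul_le_mul_right p hqs
  have hv : s * p ≤ (2 * q + 1) * p := Nat.mul_le_mul_right p hs
  refine coeff_taylor_expand_ne (h := h) (j := p) (r := p) (by rintro rfl; simp at hne) hp0
    (by omega) ?_ ?_ (hh 1 _ (s * p - p * q) ?_ ?_ ?_)
  · rw [hd, hp, Nat.add_sub_cancel]; ring
  · rw [hd, hp, Nat.add_sub_cancel, Nat.add_sub_cancel, mul_comm]
  · rw [hp]; nlinarith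
  · rw [tsub_lt_iff_right hu, hp]; rw [hp] at hv; nlinarith
  · rw [hp, Nat.add_sub_cancel, ← hp]; omega

theorem coeff_eq_coeff_card_of_mem_pairInvariants {k r : ℕ} {h : F[X]} (hk : k ≤ q)
    (hh : h ∈ pairInvariants F (q + k)) (hdeg : h.natDegree ≤ q)
    (hkr : k ≤ r) (hr : 1 ≤ r) (hrq : r ≤ q) : h.coeff r = h.coeff q := by
  set g := h - h.coeff q • geomBlock F k
  have hg : g ∈ pairInvariants F (q + k) :=
    sub_mem hh (Submodule.smul_mem _ _ (geomBlock_mem_pairInvariants hk))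
  have hcoeff (j : ℕ) : g.coeff j = h.coeff j - h.coeff q * if k ≤ j ∧ j ≤ q then 1 else 0 := by
    rw [coeff_sub, coeff_smul, coeff_geomBlock, smul_eq_mul]
  suffices hgr : g.coeff r = 0 by
    rwa [hcoeff, if_pos ⟨hkr, hrq⟩, mul_one, sub_eq_zero] at hgr
  by_contra hgr
  have hr_le : r ≤ g.natDegree := le_natDegree_of_ne_zero hgr
  have hlt : g.natDegree < q := by
    refine lt_of_le_of_ne ?_ fun heq => ?_
    · exact natDegree_sub_le_of_le hdeg
        ((natDegree_smul_le _ _).trans (natDegree_geomBlock_le k)) |>.trans_eq (max_self q)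
    · have hlead : g.coeff g.natDegree ≠ 0 :=
        leadingCoeff_ne_zero.2 (ne_zero_of_natDegree_gt (hr.trans hr_le))
      rw [heq, hcoeff, if_pos ⟨hk, le_rfl⟩, mul_one, sub_self] at hlead
      exact hlead rfl
  have := natDegree_eq_zero_of_mem_pairInvariants hg hlt (by omega) (by omega)
  omega

end OneVariable

section Slice

open MvPolynomial

section Semiring

variable {σ : Type*}

/-- The exponent vector of the monomial of exponent `i` after the substitution of `x_b` for `x_a`:
the exponents at `a` and `b` are added up at `b`. -/
noncomputable def collapse (a b : σ) (i : σ →₀ ℕ) : σ →₀ ℕ := i.erase a + Finsupp.single b (i a)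

theorem collapse_apply_right {a b : σ} (hab : a ≠ b) (i : σ →₀ ℕ) :
    collapse a b i b = i a + i b := by
  rw [collapse, Finsupp.add_apply, Finsupp.erase_ne hab.symm, Finsupp.single_eq_same, add_comm]

theorem collapse_eq_collapse_iff {a b : σ} (hab : a ≠ b) {i j : σ →₀ ℕ} :
    collapse a b i = collapse a b j ↔ i a + i b = j a + j b ∧ ∀ c, c ≠ a → c ≠ b → i c = j c := by
  refine ⟨fun h => ⟨?_, fun c hca hcb => ?_⟩, fun ⟨hsum, hoff⟩ => ?_⟩
  · rw [← collapse_apply_right hab, h, collapse_apply_right hab]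
  · simpa [collapse, hca, hcb] using DFunLike.congr_fun h c
  · ext c
    by_cases hcb : c = b
    · rw [hcb, collapse_apply_right hab, collapse_apply_right hab, hsum]
    by_cases hca : c = a
    · simp [collapse, hca, hab]
    · simp [collapse, hca, hcb, hoff c hca hcb]

theorem eq_of_collapse_eq {a b : σ} (hab : a ≠ b) {i j : σ →₀ ℕ}
    (h : collapse a b i = collapse a b j) (ha : i a = j a) : i = j := by
  obtain ⟨hsum, hoff⟩ := (collapse_eq_collapse_iff hab).1 h
  ext c
  by_cases hca : c = a
  · rw [hca, ha]
  by_cases hcb : c = b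
  · rw [hcb]; omega
  · exact hoff c hca hcb

theorem exists_collapse_eq {a b : σ} (hab : a ≠ b) (i : σ →₀ ℕ) {r t : ℕ}
    (h : r + t = i a + i b) : ∃ j, collapse a b j = collapse a b i ∧ j a = r ∧ j b = t ∧
      ∀ c, c ≠ a → c ≠ b → j c = i c := by
  classical
  have ha : ((i.update a r).update b t) a = r := by simp [hab]
  have hb : ((i.update a r).update b t) b = t := by simp
  have hoff : ∀ c, c ≠ a → c ≠ b → ((i.update a r).update b t) c = i c := fun c hca hcb => by
    simp [hca, hcb]
  exact ⟨_, (collapse_eq_collapse_iff hab).2 ⟨by rw [ha, hb, h], hoff⟩, ha, hb, hoff⟩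

theorem smul_collapse (p : ℕ) (a b : σ) (i : σ →₀ ℕ) :
    p • collapse a b i = collapse a b (p • i) := by
  classical
  ext c
  simp only [collapse, smul_add, Finsupp.smul_single, Finsupp.add_apply, Finsupp.smul_apply,
    Finsupp.erase_apply, smul_ite, smul_zero]

variable {R : Type*} [DecidableEq σ] [CommSemiring R]

/-- The substitution `x_a ↦ X x_b`, which makes `X` a bookkeeping variable for the degree in
`x_a`. -/
noncomputable def dehomog (a b : σ) :
    MvPolynomial σ R →ₐ[R] MvPolynomial σ (Polynomial R) :=
  aeval fun j => if j = a then C Polynomial.X * X b else X j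

theorem dehomog_monomial (a b : σ) (i : σ →₀ ℕ) (r : R) :
    dehomog a b (monomial i r) = monomial (collapse a b i) (Polynomial.monomial (i a) r) := by
  have hrest : dehomog a b (monomial (i.erase a) (1 : R)) = monomial (i.erase a) 1 := by
    rw [dehomog, aeval_monomial, map_one, one_mul, monomial_eq, C_1, one_mul]
    refine Finsupp.prod_congr fun j hj => ?_
    rw [if_neg (Finset.ne_of_mem_erase (Finsupp.support_erase (f := i) ▸ hj))]
  have ha : dehomog a b (X a : MvPolynomial σ R) = C Polynomial.X * X b := by
    rw [dehomog, aeval_X, if_pos rfl]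
  have hsplit : monomial i r = C r * (monomial (i.erase a) 1 * X a ^ i a) := by
    rw [X_pow_eq_monomial, monomial_mul, C_mul_monomial, mul_one, mul_one,
      Finsupp.erase_add_single]
  rw [hsplit, map_mul, map_mul, map_pow, hrest, ha, ← algebraMap_eq, AlgHom.commutes, mul_pow,
    X_pow_eq_monomial, ← C_pow, C_mul_monomial, monomial_mul,
    IsScalarTower.algebraMap_apply R (Polynomial R), algebraMap_eq, C_mul_monomial, mul_one,
    one_mul, Polynomial.algebraMap_eq, Polynomial.C_mul_X_pow_eq_monomial, collapse]

/-- The slice of `P` at `e`: the part of `P` whose exponents are collapsed to `e`, as a polynomial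
in `x_a / x_b`. -/
noncomputable def slice (a b : σ) (e : σ →₀ ℕ) : MvPolynomial σ R →ₗ[R] Polynomial R :=
  (lcoeff (Polynomial R) e).restrictScalars R ∘ₗ (dehomog a b).toLinearMap

theorem slice_monomial (a b : σ) (e i : σ →₀ ℕ) (r : R) :
    slice a b e (monomial i r) =
      if collapse a b i = e then Polynomial.monomial (i a) r else 0 := by
  change coeff e (dehomog a b (monomial i r)) = _
  rw [dehomog_monomial, coeff_monomial]

theorem coeff_slice_collapse {a b : σ} (hab : a ≠ b) (i : σ →₀ ℕ) (P : MvPolynomial σ R) :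
    (slice a b (collapse a b i) P).coeff (i a) = coeff i P := by
  induction P using MvPolynomial.induction_on' with
  | add P S hP hS => rw [map_add, Polynomial.coeff_add, coeff_add, hP, hS]
  | monomial j r =>
    rw [slice_monomial, coeff_monomial]
    by_cases hji : j = i
    · rw [hji, if_pos rfl, if_pos rfl, Polynomial.coeff_monomial, if_pos rfl]
    rw [if_neg hji]
    split_ifs with h
    · rw [Polynomial.coeff_monomial, if_neg fun ha => hji (eq_of_collapse_eq hab h ha)]
    · rw [Polynomial.coeff_zero]

theorem exists_of_coeff_slice_ne_zero {a b : σ} {e : σ →₀ ℕ} {u : ℕ} {P : MvPolynomial σ R}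
    (h : (slice a b e P).coeff u ≠ 0) : ∃ i, coeff i P ≠ 0 ∧ collapse a b i = e ∧ i a = u := by
  rw [P.as_sum, map_sum, Polynomial.finsetSum_coeff] at h
  obtain ⟨i, hi, hne⟩ := Finset.exists_ne_zero_of_sum_ne_zero h
  rw [slice_monomial] at hne
  split_ifs at hne with he
  · rw [Polynomial.coeff_monomial] at hne
    exact ⟨i, mem_support_iff.1 hi, he, by_contra fun hu => hne (if_neg hu)⟩
  · simp at hne

theorem exists_of_slice_ne_zero {a b : σ} {e : σ →₀ ℕ} {P : MvPolynomial σ R}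
    (h : slice a b e P ≠ 0) : ∃ i, coeff i P ≠ 0 ∧ collapse a b i = e := by
  obtain ⟨i, hi, he, -⟩ := exists_of_coeff_slice_ne_zero (Polynomial.leadingCoeff_ne_zero.2 h)
  exact ⟨i, hi, he⟩

theorem natDegree_slice_le {a b : σ} {e : σ →₀ ℕ} {P : MvPolynomial σ R} {M : ℕ}
    (h : ∀ i, coeff i P ≠ 0 → collapse a b i = e → i a ≤ M) : (slice a b e P).natDegree ≤ M := by
  refine Polynomial.natDegree_le_iff_coeff_eq_zero.2 fun u hu => ?_
  by_contra hne
  obtain ⟨i, hi, he, rfl⟩ := exists_of_coeff_slice_ne_zero hne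
  exact hu.not_ge (h i hi he)

theorem slice_expand {p : ℕ} (hp : p ≠ 0) (a b : σ) (e : σ →₀ ℕ) (P : MvPolynomial σ R) :
    slice a b (p • e) (expand p P) = Polynomial.expand R p (slice a b e P) := by
  induction P using MvPolynomial.induction_on' with
  | add P S hP hS => rw [map_add, map_add, map_add, map_add, hP, hS]
  | monomial i r =>
    rw [expand_monomial, slice_monomial, slice_monomial, ← smul_collapse]
    simp only [smul_right_injective (σ →₀ ℕ) hp |>.eq_iff]
    split_ifs
    · rw [Polynomial.expand_monomial, Finsupp.smul_apply, smul_eq_mul, mul_comm]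
    · rw [map_zero]

end Semiring

variable {F : Type*} [Field F] {n : ℕ}

theorem linSubst_transvection_X {a b : Fin n} (c : F) (j : Fin n) :
    linSubst (Matrix.transvection b a c) (X j) = if j = a then X a + C c * X b else X j := by
  have hone : ∑ i, C ((1 : Matrix (Fin n) (Fin n) F) i j) * X i = X j := by
    simpa only [linSubst, aeval_X, AlgHom.id_apply] using
      DFunLike.congr_fun (linSubst_one (F := F) (n := n)) (X j)
  simp only [linSubst, aeval_X, Matrix.transvection, Matrix.add_apply, C_add, add_mul,
    Finset.sum_add_distrib, hone, Matrix.single_apply]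
  by_cases hj : j = a
  · simp [hj, apply_ite C, ite_mul]
  · simp [hj, Ne.symm hj]

theorem dehomog_linSubst_transvection {a b : Fin n} (hab : a ≠ b) (c : F)
    (P : MvPolynomial (Fin n) F) :
    dehomog a b (linSubst (Matrix.transvection b a c) P) =
      mapAlgHom (Polynomial.taylorAlgHom c) (dehomog a b P) := by
  refine DFunLike.congr_fun (f := (dehomog a b).comp (linSubst (Matrix.transvection b a c)))
    (g := (mapAlgHom (Polynomial.taylorAlgHom c)).comp (dehomog a b)) ?_ P
  ext1 j
  rw [AlgHom.comp_apply, AlgHom.comp_apply, linSubst_transvection_X]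
  by_cases hj : j = a
  · simp [dehomog, hj, hab.symm, add_mul]
  · simp [dehomog, hj]

theorem slice_linSubst_transvection {a b : Fin n} (hab : a ≠ b) (c : F) (e : Fin n →₀ ℕ)
    (P : MvPolynomial (Fin n) F) :
    slice a b e (linSubst (Matrix.transvection b a c) P) =
      Polynomial.taylor c (slice a b e P) := by
  change coeff e (dehomog a b _) = Polynomial.taylor c (coeff e (dehomog a b P))
  rw [dehomog_linSubst_transvection hab, mapAlgHom_apply, coeff_map]
  rfl

end Slice

section Criterion

open MvPolynomial

variable {F : Type*} [Field F] {n : ℕ}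

theorem linSubst_diagonal_X (D : Fin n → F) (j : Fin n) :
    linSubst (Matrix.diagonal D) (X j) = C (D j) * X j := by
  rw [linSubst, aeval_X, Finset.sum_eq_single j]
  · rw [Matrix.diagonal_apply_eq]
  · intro i _ hij
    rw [Matrix.diagonal_apply_ne _ hij, C_0, zero_mul]
  · simp

theorem coeff_linSubst_diagonal (D : Fin n → F) (P : MvPolynomial (Fin n) F) (d : Fin n →₀ ℕ) :
    coeff d (linSubst (Matrix.diagonal D) P) = (∏ j, D j ^ d j) * coeff d P := by
  induction P using MvPolynomial.induction_on' with
  | add P S hP hS => simp only [map_add, coeff_add, hP, hS, mul_add]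
  | monomial i r =>
    have : linSubst (Matrix.diagonal D) (monomial i r) = C (∏ j, D j ^ i j) * monomial i r := by
      rw [monomial_eq, Finsupp.prod_fintype _ _ (fun _ => pow_zero _), map_mul, map_prod]
      simp only [map_pow, linSubst_diagonal_X, mul_pow, Finset.prod_mul_distrib, map_prod]
      rw [← algebraMap_eq, AlgHom.commutes]
      ring
    rw [this, coeff_C_mul, coeff_monomial]
    split_ifs with h
    · rw [h]
    · rw [mul_zero, mul_zero]

variable [Fintype F]

local notation "q" => Fintype.card F

theorem mem_frobIdeal_iff {m : ℕ} {P : MvPolynomial (Fin n) F} :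
    P ∈ frobIdeal F n m ↔ ∀ d : Fin n →₀ ℕ, (∀ j, d j < q ^ m) → coeff d P = 0 := by
  have hspan : frobIdeal F n m = Ideal.span ((fun s => monomial s (1 : F)) ''
      Set.range fun i : Fin n => Finsupp.single i (q ^ m)) := by
    rw [frobIdeal, ← Set.range_comp]
    simp only [Function.comp_def, X_pow_eq_monomial]
  rw [hspan, mem_ideal_span_monomial_image]
  simp only [Set.mem_range, exists_exists_eq_and, Finsupp.single_le_iff, mem_support_iff]
  refine forall_congr' fun d => ?_
  rw [← not_imp_not, not_not, not_exists]
  simp only [not_le]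

theorem mk_eq_mk_iff {m : ℕ} {P S : MvPolynomial (Fin n) F} :
    Ideal.Quotient.mk (frobIdeal F n m) P = Ideal.Quotient.mk (frobIdeal F n m) S ↔
      ∀ d : Fin n →₀ ℕ, (∀ j, d j < q ^ m) → coeff d P = coeff d S := by
  simp only [Ideal.Quotient.eq, mem_frobIdeal_iff, coeff_sub, sub_eq_zero]

theorem mk_mem_invariants_iff {m : ℕ} {P : MvPolynomial (Fin n) F} :
    Ideal.Quotient.mk _ P ∈ invariants F n m ↔ ∀ M : Matrix (Fin n) (Fin n) F, M.det ≠ 0 →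
      Ideal.Quotient.mk (frobIdeal F n m) (linSubst M P) = Ideal.Quotient.mk _ P := by
  rw [mem_invariants]
  exact ⟨fun h M hM => h (Matrix.GeneralLinearGroup.mkOfDetNeZero M hM),
    fun h g => h g g.det_ne_zero⟩

theorem mk_linSubst_mul_eq {m : ℕ} {A B : Matrix (Fin n) (Fin n) F} {P : MvPolynomial (Fin n) F}
    (hA : Ideal.Quotient.mk (frobIdeal F n m) (linSubst A P) = Ideal.Quotient.mk _ P)
    (hB : Ideal.Quotient.mk (frobIdeal F n m) (linSubst B P) = Ideal.Quotient.mk _ P) :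
    Ideal.Quotient.mk (frobIdeal F n m) (linSubst (A * B) P) = Ideal.Quotient.mk _ P := by
  refine Eq.trans ?_ hA
  rw [Ideal.Quotient.eq] at hB ⊢
  rw [linSubst_mul, AlgHom.comp_apply, ← map_sub]
  exact frobIdeal_le_comap m A hB

theorem card_sub_one_dvd_of_mk_mem_invariants {m : ℕ} {P : MvPolynomial (Fin n) F}
    (hP : Ideal.Quotient.mk _ P ∈ invariants F n m) {d : Fin n →₀ ℕ} (hd : ∀ j, d j < q ^ m)
    (hne : coeff d P ≠ 0) (j : Fin n) : q - 1 ∣ d j := by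
  rw [← FiniteField.forall_pow_eq_one_iff]
  intro u
  have hdet : (Matrix.diagonal (Function.update (1 : Fin n → F) j (u : F))).det ≠ 0 := by
    rw [Matrix.det_diagonal, Finset.prod_update_of_mem (Finset.mem_univ j)]
    simp
  have hprod := mk_eq_mk_iff.1 (mk_mem_invariants_iff.1 hP _ hdet) d hd
  rw [coeff_linSubst_diagonal, mul_eq_right₀ hne, Finset.prod_eq_single j
    (fun i _ hij => by rw [Function.update_of_ne hij, Pi.one_apply, one_pow])
    (fun h => absurd (Finset.mem_univ j) h), Function.update_self] at hprod
  exact Units.ext (by rw [Units.val_pow_eq_pow_val, hprod, Units.val_one])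

theorem linSubst_diagonal_expand {D : Fin n → F} (hD : ∀ j, D j ≠ 0)
    (R : MvPolynomial (Fin n) F) :
    linSubst (Matrix.diagonal D) (expand (q - 1) R) = expand (q - 1) R := by
  refine DFunLike.congr_fun (f := (linSubst (Matrix.diagonal D)).comp (expand (q - 1)))
    (g := expand (q - 1)) ?_ R
  ext1 j
  rw [AlgHom.comp_apply, expand_X, map_pow, linSubst_diagonal_X, mul_pow, ← C_pow,
    FiniteField.pow_card_sub_one_eq_one _ (hD j), C_1, one_mul]

theorem mk_expand_mem_invariants_iff {m : ℕ} {R : MvPolynomial (Fin n) F} :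
    Ideal.Quotient.mk _ (expand (q - 1) R) ∈ invariants F n m ↔
      ∀ a b : Fin n, a ≠ b → ∀ c : F,
        Ideal.Quotient.mk (frobIdeal F n m)
            (linSubst (Matrix.transvection b a c) (expand (q - 1) R)) =
          Ideal.Quotient.mk (frobIdeal F n m) (expand (q - 1) R) := by
  rw [mk_mem_invariants_iff]
  refine ⟨fun h a b hab c => h _ ?_, fun h M hM => ?_⟩
  · rw [Matrix.det_transvection_of_ne _ _ hab.symm]
    exact one_ne_zero
  · refine Matrix.diagonal_transvection_induction_of_det_ne_zero
      (fun M => Ideal.Quotient.mk (frobIdeal F n m) (linSubst M (expand (q - 1) R)) =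
        Ideal.Quotient.mk _ (expand (q - 1) R)) M hM (fun D hD => ?_) (fun t => ?_)
      fun A B _ _ => mk_linSubst_mul_eq
    · rw [Matrix.det_diagonal, Finset.prod_ne_zero_iff] at hD
      rw [linSubst_diagonal_expand fun j => hD j (Finset.mem_univ j)]
    · exact h t.j t.i t.hij.symm t.c

theorem mk_linSubst_transvection_expand_eq_iff {a b : Fin n} (hab : a ≠ b)
    {R : MvPolynomial (Fin n) F} (hR : R ∈ restrictDegree (Fin n) F (q + 1)) :
    (∀ c : F, Ideal.Quotient.mk (frobIdeal F n 2)
        (linSubst (Matrix.transvection b a c) (expand (q - 1) R)) =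
          Ideal.Quotient.mk (frobIdeal F n 2) (expand (q - 1) R)) ↔
      ∀ e, slice a b e R ∈ pairInvariants F (e b) := by
  have hq : q - 1 ≠ 0 := (Nat.sub_pos_of_lt Fintype.one_lt_card).ne'
  refine ⟨fun h e c u v hu hv huv => ?_, fun h c => mk_eq_mk_iff.2 fun d hd => ?_⟩
  · by_cases hslice : slice a b e R = 0
    · rw [hslice, map_zero, map_zero]
    obtain ⟨i, hi, rfl⟩ := exists_of_slice_ne_zero hslice
    rw [collapse_apply_right hab, mul_comm, mul_add] at huv
    obtain ⟨d, hd, rfl, rfl, hoff⟩ := exists_collapse_eq hab ((q - 1) • i) huv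
    rw [← slice_expand hq, smul_collapse, ← slice_linSubst_transvection hab, ← hd,
      coeff_slice_collapse hab, coeff_slice_collapse hab]
    refine mk_eq_mk_iff.1 (h c) d fun j => ?_
    by_cases hja : j = a
    · rwa [hja]
    by_cases hjb : j = b
    · rwa [hjb]
    rw [hoff j hja hjb, Finsupp.smul_apply, smul_eq_mul, mul_comm, mul_card_sub_one_lt_card_sq_iff]
    exact (mem_restrictDegree _ _ _).1 hR i (mem_support_iff.2 hi) j
  · rw [← coeff_slice_collapse hab, ← coeff_slice_collapse hab, slice_linSubst_transvection hab]
    by_cases hslice : slice a b (collapse a b d) (expand (q - 1) R) = 0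
    · rw [hslice, map_zero]
    obtain ⟨i, hi, hid⟩ := exists_of_slice_ne_zero hslice
    rw [← mem_support_iff, support_expand _ hq, Finset.mem_image] at hi
    obtain ⟨i, -, rfl⟩ := hi
    have hsum := ((collapse_eq_collapse_iff hab).1 hid).1
    rw [← hid, ← smul_collapse, slice_expand hq]
    refine h _ c (d a) (d b) (hd a) (hd b) ?_
    rw [← hsum, collapse_apply_right hab, mul_comm, mul_add]
    rfl

variable (F n) in
/-- The class in `Q` of `R(x_1 ^ (q - 1), …, x_n ^ (q - 1))`. -/
noncomputable def expandMk : MvPolynomial (Fin n) F →ₐ[F] Q F n 2 :=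
  (Ideal.Quotient.mkₐ F (frobIdeal F n 2)).comp (expand (q - 1))

theorem expandMk_apply (R : MvPolynomial (Fin n) F) :
    expandMk F n R = Ideal.Quotient.mk _ (expand (q - 1) R) := rfl

variable (F n) in
/-- The polynomials of degree at most `q + 1` in each variable that become invariant after the
substitution `x_j ↦ x_j ^ (q - 1)`. Each invariant comes from exactly one of them, see
`reducedInvariantsEquiv`. -/
noncomputable def reducedInvariants : Submodule F (MvPolynomial (Fin n) F) :=
  restrictDegree (Fin n) F (q + 1) ⊓
    (Subalgebra.toSubmodule (invariants F n 2)).comap (expandMk F n).toLinearMap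

theorem mem_reducedInvariants {R : MvPolynomial (Fin n) F} :
    R ∈ reducedInvariants F n ↔
      R ∈ restrictDegree (Fin n) F (q + 1) ∧ expandMk F n R ∈ invariants F n 2 :=
  Iff.rfl

theorem mem_reducedInvariants_iff_slice_mem {R : MvPolynomial (Fin n) F} :
    R ∈ reducedInvariants F n ↔ R ∈ restrictDegree (Fin n) F (q + 1) ∧
      ∀ a b, a ≠ b → ∀ e, slice a b e R ∈ pairInvariants F (e b) := by
  rw [mem_reducedInvariants, expandMk_apply, mk_expand_mem_invariants_iff]
  exact and_congr_right fun hR =>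
    forall₃_congr fun a b hab => mk_linSubst_transvection_expand_eq_iff hab hR

end Criterion

section Reduced

open MvPolynomial

variable {F : Type*} [Field F] [Fintype F] {n : ℕ}

local notation "q" => Fintype.card F

theorem expandMk_injOn : Set.InjOn (expandMk F n) (restrictDegree (Fin n) F (q + 1)) := by
  have hq : q - 1 ≠ 0 := (Nat.sub_pos_of_lt Fintype.one_lt_card).ne'
  intro R hR S hS h
  ext i
  by_cases hi : ∀ j, i j ≤ q + 1
  · rw [← coeff_expand_smul _ hq R, ← coeff_expand_smul _ hq S]
    refine mk_eq_mk_iff.1 h _ fun j => ?_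
    rw [Finsupp.smul_apply, smul_eq_mul, mul_comm, mul_card_sub_one_lt_card_sq_iff]
    exact hi j
  · have hzero {T : MvPolynomial (Fin n) F} (hT : T ∈ restrictDegree (Fin n) F (q + 1)) :
        coeff i T = 0 :=
      notMem_support_iff.1 fun hmem => hi ((mem_restrictDegree _ _ _).1 hT i hmem)
    rw [hzero hR, hzero hS]

theorem exists_expandMk_eq_of_mem_invariants {f : Q F n 2} (hf : f ∈ invariants F n 2) :
    ∃ R ∈ reducedInvariants F n, expandMk F n R = f := by
  have hq : q - 1 ≠ 0 := (Nat.sub_pos_of_lt Fintype.one_lt_card).ne'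
  obtain ⟨P, rfl⟩ := Ideal.Quotient.mk_surjective f
  let B := Finset.Iic (Finsupp.equivFunOnFinite.symm fun _ : Fin n => q + 1)
  have hB {i : Fin n →₀ ℕ} : i ∈ B ↔ ∀ j, i j ≤ q + 1 := Finset.mem_Iic
  let R := ∑ i ∈ B, monomial i (coeff ((q - 1) • i) P)
  have hcoeff (i : Fin n →₀ ℕ) : coeff i R = if i ∈ B then coeff ((q - 1) • i) P else 0 := by
    simp only [R, coeff_sum, coeff_monomial, Finset.sum_ite_eq']
  suffices hR : expandMk F n R = Ideal.Quotient.mk _ P by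
    refine ⟨R, mem_reducedInvariants.2 ⟨(mem_restrictDegree _ _ _).2 fun i hi => ?_, hR ▸ hf⟩, hR⟩
    by_contra hiB
    rw [mem_support_iff, hcoeff, if_neg (mt hB.1 hiB)] at hi
    exact hi rfl
  refine (expandMk_apply R).trans (mk_eq_mk_iff.2 fun d hd => ?_)
  by_cases hdvd : ∀ j, q - 1 ∣ d j
  · choose i hi using hdvd
    obtain rfl : d = (q - 1) • Finsupp.equivFunOnFinite.symm i := Finsupp.ext hi
    rw [coeff_expand_smul _ hq, hcoeff, if_pos (hB.2 fun j => ?_)]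
    rw [← mul_card_sub_one_lt_card_sq_iff F, mul_comm]
    exact hd j
  · obtain ⟨j, hj⟩ := not_forall.1 hdvd
    rw [coeff_expand_of_not_dvd _ hj]
    by_contra hne
    exact hj (card_sub_one_dvd_of_mk_mem_invariants hf hd (Ne.symm hne) j)

variable (F n) in
/-- Every invariant of `Q` is the class of `R(x_1 ^ (q - 1), …, x_n ^ (q - 1))` for a unique
reduced `R`. -/
noncomputable def reducedInvariantsEquiv : reducedInvariants F n ≃ₗ[F] invariants F n 2 :=
  (LinearEquiv.ofBijective
    (((expandMk F n).toLinearMap.domRestrict (reducedInvariants F n)).codRestrict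
      (Subalgebra.toSubmodule (invariants F n 2)) fun R => R.2.2)
    ⟨fun R S h => Subtype.ext (expandMk_injOn R.2.1 S.2.1 (congrArg Subtype.val h)),
      fun f => by
        obtain ⟨R, hR, hRf⟩ := exists_expandMk_eq_of_mem_invariants f.2
        exact ⟨⟨R, hR⟩, Subtype.ext hRf⟩⟩).trans
    (Subalgebra.toSubmoduleEquiv _)

theorem coe_reducedInvariantsEquiv (R : reducedInvariants F n) :
    (reducedInvariantsEquiv F n R : Q F n 2) = expandMk F n R := rfl

end Reduced

section Coefficients

open MvPolynomial

variable {F : Type*} [Field F] [Fintype F] {n : ℕ}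

local notation "q" => Fintype.card F

variable {R : MvPolynomial (Fin n) F} (hR : R ∈ reducedInvariants F n)

include hR

theorem apply_le_card_add_one {i : Fin n →₀ ℕ} (hi : coeff i R ≠ 0) (a : Fin n) : i a ≤ q + 1 :=
  (mem_restrictDegree _ _ _).1 hR.1 i (mem_support_iff.2 hi) a

theorem slice_collapse_mem_pairInvariants {a b : Fin n} (hab : a ≠ b) (i : Fin n →₀ ℕ) :
    slice a b (collapse a b i) R ∈ pairInvariants F (i a + i b) :=
  collapse_apply_right hab i ▸ (mem_reducedInvariants_iff_slice_mem.1 hR).2 a b hab _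

theorem apply_eq_card_add_one {i : Fin n →₀ ℕ} (hi : coeff i R ≠ 0) {a : Fin n}
    (ha : i a = q + 1) (b : Fin n) : i b = q + 1 := by
  by_contra hb
  have hab : a ≠ b := fun h => hb (h ▸ ha)
  have hb_le := apply_le_card_add_one hR hi b
  refine hi ?_
  rw [← coeff_slice_collapse hab, ha]
  exact coeff_card_add_one_eq_zero_of_mem_pairInvariants
    (slice_collapse_mem_pairInvariants hR hab i)
    (natDegree_slice_le fun j hj _ => apply_le_card_add_one hR hj a) (by omega) (by omega)

theorem coeff_eq_zero_of_add_lt_card {i : Fin n →₀ ℕ} {a b : Fin n} (hab : a ≠ b)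
    (ha : i a ≠ 0) (hsum : i a + i b < q) : coeff i R = 0 := by
  have hdeg : (slice a b (collapse a b i) R).natDegree ≤ i a + i b :=
    natDegree_slice_le fun j _ hj => by
      have := ((collapse_eq_collapse_iff hab).1 hj).1
      omega
  have hzero := natDegree_eq_zero_of_mem_pairInvariants
    (slice_collapse_mem_pairInvariants hR hab i) (by omega) hdeg (by omega)
  rw [← coeff_slice_collapse hab]
  exact Polynomial.coeff_eq_zero_of_natDegree_lt (by omega)

theorem coeff_eq_coeff_slice_card {i : Fin n →₀ ℕ} {a b : Fin n} (hab : a ≠ b) (ha : i a ≤ q)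
    (hb : i b ≤ q) (hsum : q ≤ i a + i b) (ha0 : i a ≠ 0) :
    coeff i R = (slice a b (collapse a b i) R).coeff q := by
  obtain ⟨k, hk⟩ := Nat.exists_eq_add_of_le hsum
  have hdeg : (slice a b (collapse a b i) R).natDegree ≤ q :=
    natDegree_slice_le fun j hj hji => by
      by_contra hja
      have hja' : j a = q + 1 := by have := apply_le_card_add_one hR hj a; omega
      have hjb := apply_eq_card_add_one hR hj hja' b
      have := ((collapse_eq_collapse_iff hab).1 hji).1
      omega
  rw [← coeff_slice_collapse hab]
  exact coeff_eq_coeff_card_of_mem_pairInvariants (by omega)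
    (hk ▸ slice_collapse_mem_pairInvariants hR hab i) hdeg (by omega) (by omega) ha

theorem coeff_eq_coeff_of_ne_zero {i j : Fin n →₀ ℕ} {a b : Fin n} (hab : a ≠ b)
    (hij : collapse a b i = collapse a b j) (hia : i a ≤ q) (hib : i b ≤ q) (hja : j a ≤ q)
    (hjb : j b ≤ q) (hsum : q ≤ i a + i b) (hj : j a ≠ 0 ∧ j b ≠ 0) : coeff i R = coeff j R := by
  obtain ⟨hsum_eq, hoff⟩ := (collapse_eq_collapse_iff hab).1 hij
  by_cases hi : i a = 0
  · rw [coeff_eq_coeff_slice_card hR hab.symm hib hia (by omega) (by omega),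
      coeff_eq_coeff_slice_card hR hab.symm hjb hja (by omega) hj.2,
      (collapse_eq_collapse_iff hab.symm).2 ⟨by omega, fun c hb ha => hoff c ha hb⟩]
  · rw [coeff_eq_coeff_slice_card hR hab hia hib hsum hi,
      coeff_eq_coeff_slice_card hR hab hja hjb (by omega) hj.1, hij]

theorem coeff_eq_coeff_of_collapse_eq {i j : Fin n →₀ ℕ} {a b : Fin n} (hab : a ≠ b)
    (hij : collapse a b i = collapse a b j) (hia : i a ≤ q) (hib : i b ≤ q) (hja : j a ≤ q)
    (hjb : j b ≤ q) (hsum : q ≤ i a + i b) : coeff i R = coeff j R := by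
  have hq : 1 < q := Fintype.one_lt_card
  obtain ⟨r, t, hrt, hr, ht, hrq, htq⟩ :
      ∃ r t, r + t = i a + i b ∧ r ≠ 0 ∧ t ≠ 0 ∧ r ≤ q ∧ t ≤ q := by
    by_cases hs : i a + i b = q
    · exact ⟨1, q - 1, by omega, by omega, by omega, by omega, by omega⟩
    · exact ⟨i a + i b - q, q, by omega, by omega, by omega, by omega, le_rfl⟩
  obtain ⟨m, hm, rfl, rfl, -⟩ := exists_collapse_eq hab i hrt
  have hsum_eq := ((collapse_eq_collapse_iff hab).1 hij).1
  rw [coeff_eq_coeff_of_ne_zero hR hab hm.symm hia hib hrq htq hsum ⟨hr, ht⟩,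
    coeff_eq_coeff_of_ne_zero hR hab (hij ▸ hm.symm) hja hjb hrq htq (by omega) ⟨hr, ht⟩]

theorem card_le_add_of_coeff_ne_zero {i : Fin n →₀ ℕ} (hi : coeff i R ≠ 0) (hi0 : i ≠ 0)
    (hle : ∀ c, i c ≤ q) {a b : Fin n} (hab : a ≠ b) : q ≤ i a + i b := by
  have hq : 1 < q := Fintype.one_lt_card
  by_contra! hlt
  have ha : i a = 0 := by
    by_contra ha
    exact hi (coeff_eq_zero_of_add_lt_card hR hab ha hlt)
  have hb : i b = 0 := by
    by_contra hb
    exact hi (coeff_eq_zero_of_add_lt_card hR hab.symm hb (by omega))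
  obtain ⟨c, hc⟩ := Finsupp.ne_iff.1 hi0
  have hca : c ≠ a := fun h => hc (h ▸ ha)
  have hcb : c ≠ b := fun h => hc (h ▸ hb)
  have hcq : i c = q := by
    by_contra hcq
    have := hle c
    exact hi (coeff_eq_zero_of_add_lt_card hR hca hc (by omega))
  obtain ⟨j, hj, hjc, hja, hoff⟩ := exists_collapse_eq hca i (r := q - 1) (t := 1) (by omega)
  have hjb : j b = 0 := (hoff b hcb.symm hab.symm).trans hb
  refine hi ((coeff_eq_coeff_of_collapse_eq hR hca hj.symm ?_ ?_ ?_ ?_ ?_).trans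
    (coeff_eq_zero_of_add_lt_card hR hab (by omega) (by omega)))
  all_goals omega

omit hR in
variable (F) in
/-- The exponents `q, …, q, k, q, …, q` with `k` at position `a`: the exponents by which the
coefficient of `y_{n,k}` in an invariant is read off. -/
noncomputable def cornerExponent (a : Fin n) (k : ℕ) : Fin n →₀ ℕ :=
  Finsupp.equivFunOnFinite.symm (Function.update (fun _ => q) a k)

theorem exists_coeff_ne_zero_and_apply_eq_card {i : Fin n →₀ ℕ} (hi : coeff i R ≠ 0)
    (hi0 : i ≠ 0) (hle : ∀ c, i c ≤ q) (a : Fin n) (T : Finset (Fin n)) (ha : a ∉ T) :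
    ∃ j, coeff j R ≠ 0 ∧ j ≠ 0 ∧ (∀ c, j c ≤ q) ∧ ∀ b ∈ T, j b = q := by
  induction T using Finset.induction with
  | empty => exact ⟨i, hi, hi0, hle, fun b hb => absurd hb (Finset.notMem_empty b)⟩
  | insert b T _ ih =>
    rw [Finset.mem_insert, not_or] at ha
    obtain ⟨j, hj, hj0, hjle, hjT⟩ := ih ha.2
    have hsum := card_le_add_of_coeff_ne_zero hR hj hj0 hjle ha.1
    have hja := hjle a
    have hjb := hjle b
    obtain ⟨m, hm, hma, hmb, hoff⟩ :=
      exists_collapse_eq ha.1 j (r := j a + j b - q) (t := q) (by omega)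
    have hmT : ∀ c ∈ insert b T, m c = q := fun c hc => by
      by_cases hcb : c = b
      · rw [hcb, hmb]
      · have hcT := Finset.mem_of_mem_insert_of_ne hc hcb
        rw [hoff c (fun h => ha.2 (h ▸ hcT)) hcb, hjT c hcT]
    refine ⟨m, ?_, fun h => ?_, fun c => ?_, hmT⟩
    · rwa [coeff_eq_coeff_of_collapse_eq hR ha.1 hm (by omega) hmb.le hja hjb (by omega)]
    · rw [h, Finsupp.zero_apply] at hmb
      exact Fintype.card_ne_zero hmb.symm
    · by_cases hca : c = a
      · rw [hca]; omega
      by_cases hcb : c = b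
      · rw [hcb, hmb]
      · rw [hoff c hca hcb]
        exact hjle c

theorem exists_coeff_cornerExponent_ne_zero {i : Fin n →₀ ℕ} (hi : coeff i R ≠ 0) (hi0 : i ≠ 0)
    (hle : ∀ c, i c ≤ q) (a : Fin n) : ∃ k ≤ q, coeff (cornerExponent F a k) R ≠ 0 := by
  obtain ⟨j, hj, -, hjle, hjq⟩ := exists_coeff_ne_zero_and_apply_eq_card hR hi hi0 hle a
    (Finset.univ.erase a) (Finset.notMem_erase a _)
  have hcorner : j = cornerExponent F a (j a) := by
    ext b
    by_cases hb : b = a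
    · simp [cornerExponent, hb]
    · simp [cornerExponent, hb, hjq]
  exact ⟨j a, hjle a, hcorner ▸ hj⟩

omit hR in
variable (F n) in
/-- The exponents `q + 1, …, q + 1` of `z_n` after extracting `(q - 1)`-st roots of the
variables. -/
noncomputable def topExponent : Fin n →₀ ℕ := Finsupp.equivFunOnFinite.symm fun _ => q + 1

theorem eq_zero_of_coeff_eq_zero (a : Fin n) (h0 : coeff 0 R = 0)
    (hcorner : ∀ k ≤ q, coeff (cornerExponent F a k) R = 0)
    (htop : coeff (topExponent F n) R = 0) : R = 0 := by
  ext i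
  by_contra hi
  rw [coeff_zero] at hi
  by_cases hle : ∀ b, i b ≤ q
  · obtain ⟨k, hk, hne⟩ :=
      exists_coeff_cornerExponent_ne_zero hR hi (fun h => hi (h ▸ h0)) hle a
    exact hne (hcorner k hk)
  · obtain ⟨b, hb⟩ := not_forall.1 hle
    have hb' : i b = q + 1 := by have := apply_le_card_add_one hR hi b; omega
    have : i = topExponent F n := Finsupp.ext (apply_eq_card_add_one hR hi hb')
    exact hi (this ▸ htop)

end Coefficients

section Generators

open MvPolynomial

variable {F : Type*} {n : ℕ}

theorem degree_collapse {a b : Fin n} (i : Fin n →₀ ℕ) : (collapse a b i).degree = i.degree := by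
  conv_rhs => rw [← Finsupp.erase_add_single a i]
  simp only [collapse, map_add, Finsupp.degree_single]

theorem le_add_of_le_degree {a b : Fin n} (hab : a ≠ b) {i : Fin n →₀ ℕ} {M : ℕ}
    (hi : ∀ j, i j ≤ M) (h : (n - 1) * M ≤ i.degree) : M ≤ i a + i b := by
  have hcompl : ∑ j ∈ {a, b}ᶜ, i j ≤ (n - 2) * M := by
    refine (Finset.sum_le_card_nsmul _ _ M fun j _ => hi j).trans_eq ?_
    rw [Finset.card_compl, Finset.card_pair hab, Fintype.card_fin, smul_eq_mul]
  rw [Finsupp.degree_eq_sum, ← Finset.sum_add_sum_compl {a, b}, Finset.sum_pair hab] at h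
  have hn : n - 1 = n - 2 + 1 := by
    have := Finset.card_le_univ ({a, b} : Finset (Fin n))
    rw [Finset.card_pair hab, Fintype.card_fin] at this
    omega
  rw [hn, add_mul, one_mul] at h
  omega

variable [Fintype F]

local notation "q" => Fintype.card F

theorem degree_cornerExponent (a : Fin n) (k : ℕ) :
    (cornerExponent F a k).degree = (n - 1) * q + k := by
  simp only [Finsupp.degree_eq_sum, cornerExponent, Finsupp.equivFunOnFinite_symm_apply_apply]
  rw [Finset.sum_update_of_mem (Finset.mem_univ a), Finset.sum_const,
    Finset.card_sdiff_of_subset (Finset.subset_univ _), Finset.card_singleton, Finset.card_univ,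
    Fintype.card_fin, smul_eq_mul, add_comm]

theorem cornerExponent_apply_le (a : Fin n) {k : ℕ} (hk : k ≤ q) (j : Fin n) :
    cornerExponent F a k j ≤ q := by
  rw [cornerExponent, Finsupp.equivFunOnFinite_symm_apply_apply, Function.update_apply]
  split_ifs
  exacts [hk, le_rfl]

variable [Field F]

variable (F n) in
/-- The polynomial obtained from `yPoly F n k` by extracting `(q - 1)`-st roots of the variables:
the sum of the monomials of degree `(n - 1) * q + k` with all exponents at most `q`. -/
noncomputable def reducedY (k : ℕ) : MvPolynomial (Fin n) F :=
  ∑ i ∈ Finset.Iic (Finsupp.equivFunOnFinite.symm fun _ : Fin n => q) with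
    i.degree = (n - 1) * q + k, monomial i 1

theorem coeff_reducedY (k : ℕ) (i : Fin n →₀ ℕ) :
    coeff i (reducedY F n k) = if (∀ j, i j ≤ q) ∧ i.degree = (n - 1) * q + k then 1 else 0 := by
  simp only [reducedY, coeff_sum, coeff_monomial, Finset.sum_ite_eq', Finset.mem_filter,
    Finset.mem_Iic]
  exact if_congr Iff.rfl rfl rfl

theorem coeff_reducedY_ne_zero_iff {k : ℕ} {i : Fin n →₀ ℕ} :
    coeff i (reducedY F n k) ≠ 0 ↔ (∀ j, i j ≤ q) ∧ i.degree = (n - 1) * q + k := by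
  rw [coeff_reducedY, ne_eq, ite_eq_right_iff, Classical.not_imp]
  exact and_iff_left one_ne_zero

theorem isHomogeneous_reducedY (k : ℕ) : (reducedY F n k).IsHomogeneous ((n - 1) * q + k) :=
  IsHomogeneous.sum _ _ _ fun _ hi => isHomogeneous_monomial _ (Finset.mem_filter.1 hi).2

theorem expand_reducedY (k : ℕ) : expand (q - 1) (reducedY F n k) = yPoly F n k := by
  rw [reducedY, yPoly, map_sum]
  symm
  refine Finset.sum_nbij (fun i => Finsupp.equivFunOnFinite.symm fun j => (i j : ℕ)) ?_ ?_ ?_ ?_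
  · intro i hi
    rw [Finset.mem_filter] at hi ⊢
    exact ⟨Finset.mem_Iic.2 fun j => Nat.le_of_lt_succ (i j).isLt,
      (Finsupp.degree_eq_sum _).trans hi.2⟩
  · intro i _ j _ hij
    exact funext fun l => Fin.ext (DFunLike.congr_fun hij l)
  · intro i hi
    rw [Finset.mem_coe, Finset.mem_filter, Finset.mem_Iic, Finsupp.degree_eq_sum] at hi
    exact ⟨fun j => ⟨i j, Nat.lt_succ_of_le (hi.1 j)⟩,
      Finset.mem_coe.2 (Finset.mem_filter.2 ⟨Finset.mem_univ _, hi.2⟩), Finsupp.ext fun _ => rfl⟩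
  · intro i _
    rw [expand_monomial, monomial_eq, C_1, one_mul, Finsupp.prod_fintype _ _ fun _ => pow_zero _]
    refine Finset.prod_congr rfl fun j _ => ?_
    rw [Finsupp.smul_apply, smul_eq_mul, mul_comm]
    rfl

theorem expand_monomial_topExponent :
    expand (q - 1) (monomial (topExponent F n) (1 : F)) = zPoly F n := by
  rw [expand_monomial, monomial_eq, C_1, one_mul, Finsupp.prod_fintype _ _ fun _ => pow_zero _,
    zPoly]
  refine Finset.prod_congr rfl fun j _ => ?_
  rw [Finsupp.smul_apply, smul_eq_mul, mul_comm, ← one_pow 2, Nat.sq_sub_sq, one_pow]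
  rfl

theorem slice_reducedY {a b : Fin n} (hab : a ≠ b) {k l : ℕ} {i : Fin n →₀ ℕ}
    (hi : coeff i (reducedY F n k) ≠ 0) (hl : i a + i b = q + l) :
    slice a b (collapse a b i) (reducedY F n k) = geomBlock F l := by
  obtain ⟨hle, hdeg⟩ := coeff_reducedY_ne_zero_iff.1 hi
  ext r
  rw [coeff_geomBlock]
  by_cases hr : r ≤ q + l
  · obtain ⟨j, hj, rfl, hjb, hoff⟩ :=
      exists_collapse_eq hab i (r := r) (t := q + l - r) (by omega)
    rw [← hj, coeff_slice_collapse hab, coeff_reducedY]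
    refine if_congr ⟨fun h => ?_, fun h => ⟨fun c => ?_, ?_⟩⟩ rfl rfl
    · have := h.1 a
      have := h.1 b
      omega
    · by_cases hca : c = a
      · exact hca ▸ h.2
      by_cases hcb : c = b
      · rw [hcb, hjb]
        omega
      exact hoff c hca hcb ▸ hle c
    · rw [← degree_collapse, hj, degree_collapse, hdeg]
  · rw [if_neg fun h => hr (by omega)]
    by_contra hne
    obtain ⟨j, -, hj, rfl⟩ := exists_of_coeff_slice_ne_zero hne
    have := ((collapse_eq_collapse_iff hab).1 hj).1
    omega

theorem reducedY_mem_reducedInvariants (k : ℕ) : reducedY F n k ∈ reducedInvariants F n := by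
  refine mem_reducedInvariants_iff_slice_mem.2
    ⟨(mem_restrictDegree _ _ _).2 fun i hi j => ?_, fun a b hab e => ?_⟩
  · exact ((coeff_reducedY_ne_zero_iff.1 (mem_support_iff.1 hi)).1 j).trans (Nat.le_succ _)
  · by_cases hslice : slice a b e (reducedY F n k) = 0
    · exact hslice ▸ zero_mem _
    obtain ⟨i, hi, rfl⟩ := exists_of_slice_ne_zero hslice
    obtain ⟨hle, hdeg⟩ := coeff_reducedY_ne_zero_iff.1 hi
    obtain ⟨l, hl⟩ := Nat.exists_eq_add_of_le
      (le_add_of_le_degree hab hle (hdeg ▸ Nat.le_add_right _ _))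
    rw [slice_reducedY hab hi hl, collapse_apply_right hab, hl]
    have := hle a
    have := hle b
    exact geomBlock_mem_pairInvariants (by omega)

theorem monomial_topExponent_mem_reducedInvariants :
    monomial (topExponent F n) 1 ∈ reducedInvariants F n := by
  refine mem_reducedInvariants_iff_slice_mem.2
    ⟨(mem_restrictDegree _ _ _).2 fun i hi j => ?_, fun a b hab e => ?_⟩
  · rw [Finset.mem_singleton.1 (support_monomial_subset hi)]
    exact le_rfl
  · rw [slice_monomial]
    split_ifs with he
    · rw [← he, collapse_apply_right hab, ← Polynomial.X_pow_eq_monomial]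
      exact (two_mul (q + 1)) ▸ X_pow_card_add_one_mem_pairInvariants
    · exact zero_mem _

theorem one_mem_reducedInvariants : 1 ∈ reducedInvariants F n := by
  refine mem_reducedInvariants.2 ⟨(mem_restrictDegree _ _ _).2 fun i hi j => ?_, ?_⟩
  · rw [Finset.mem_singleton.1 (support_monomial_subset hi)]
    exact Nat.zero_le _
  · exact (map_one (expandMk F n)).symm ▸ one_mem _

end Generators

section HilbertSeries

open MvPolynomial

variable {F : Type*} [Field F] [Fintype F] {n m : ℕ}

theorem mk_homogeneousComponent_eq_of_mk_eq {P S : MvPolynomial (Fin n) F}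
    (h : Ideal.Quotient.mk (frobIdeal F n m) P = Ideal.Quotient.mk (frobIdeal F n m) S) (d : ℕ) :
    Ideal.Quotient.mk (frobIdeal F n m) (homogeneousComponent d P) =
      Ideal.Quotient.mk (frobIdeal F n m) (homogeneousComponent d S) :=
  mk_eq_mk_iff.2 fun e he => by
    rw [coeff_homogeneousComponent, coeff_homogeneousComponent, mk_eq_mk_iff.1 h e he]

variable {ι : Type*} (b : Module.Basis ι F (invariants F n m)) {D : ι → ℕ}
  (hb : ∀ i, (b i : Q F n m) ∈ degreePart F n m (D i))

include hb

theorem invariants_inf_degreePart_eq_span [Finite ι] (d : ℕ) :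
    Subalgebra.toSubmodule (invariants F n m) ⊓ degreePart F n m d =
      Submodule.span F (Set.range fun i : {i // D i = d} => (b i : Q F n m)) := by
  cases nonempty_fintype ι
  refine le_antisymm ?_ (Submodule.span_le.2 ?_)
  · rintro _ ⟨hf, P, hP, rfl⟩
    choose R hR hRb using hb
    let c := b.repr ⟨_, hf⟩
    have hPR : Ideal.Quotient.mk (frobIdeal F n m) P =
        Ideal.Quotient.mk (frobIdeal F n m) (∑ i, c i • R i) := by
      have hsum := congrArg (invariants F n m).val (b.sum_repr ⟨_, hf⟩)
      simp only [map_sum, map_smul, Subalgebra.coe_val, ← hRb] at hsum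
      exact hsum.symm.trans (by rw [map_sum]; rfl)
    have hcomp := mk_homogeneousComponent_eq_of_mk_eq hPR d
    rw [homogeneousComponent_of_mem hP, if_pos rfl] at hcomp
    change Ideal.Quotient.mk (frobIdeal F n m) P ∈ _
    rw [hcomp, map_sum, map_sum]
    refine Submodule.sum_mem _ fun i _ => ?_
    rw [map_smul, homogeneousComponent_of_mem (hR i)]
    split_ifs with hi
    · rw [show Ideal.Quotient.mk (frobIdeal F n m) (c i • R i) = c i • (b i : Q F n m) from
        congrArg (c i • ·) (hRb i)]
      exact Submodule.smul_mem _ _ (Submodule.subset_span ⟨⟨i, hi.symm⟩, rfl⟩)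
    · rw [smul_zero, map_zero]
      exact zero_mem _
  · rintro _ ⟨⟨i, rfl⟩, rfl⟩
    exact ⟨(b i).2, hb i⟩

theorem hilbertSeries_eq_sum_of_basis [Fintype ι] :
    hilbertSeries F n m = ∑ i, PowerSeries.X ^ D i := by
  classical
  ext d
  have hli : LinearIndependent F fun i : {i // D i = d} => (b i : Q F n m) :=
    (b.linearIndependent.map' (invariants F n m).val.toLinearMap
      (LinearMap.ker_eq_bot.2 Subtype.val_injective)).comp _ Subtype.val_injective
  rw [hilbertSeries, PowerSeries.coeff_mk, invariants_inf_degreePart_eq_span b hb,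
    finrank_span_eq_card hli, Fintype.card_subtype, map_sum]
  simp only [PowerSeries.coeff_X_pow, Finset.sum_boole, eq_comm]

end HilbertSeries

section Basis

open MvPolynomial

variable {F : Type*} [Field F] [Fintype F] {n : ℕ}

local notation "q" => Fintype.card F

theorem expandMk_mem_degreePart {R : MvPolynomial (Fin n) F} {d : ℕ} (hR : R.IsHomogeneous d) :
    expandMk F n R ∈ degreePart F n 2 ((q - 1) * d) :=
  ⟨expand (q - 1) R, hR.aeval _ fun i => by simpa using (isHomogeneous_X F i).pow (q - 1), rfl⟩

theorem exists_basis_of_coeff_eq_ite {ι : Type*} [Finite ι] [DecidableEq ι]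
    {R : ι → MvPolynomial (Fin n) F} (hR : ∀ i, R i ∈ reducedInvariants F n)
    {δ : ι → Fin n →₀ ℕ} (hdual : ∀ i j, coeff (δ i) (R j) = if i = j then 1 else 0)
    (htotal : ∀ S ∈ reducedInvariants F n, (∀ i, coeff (δ i) S = 0) → S = 0) :
    ∃ b : Module.Basis ι F (invariants F n 2), ∀ i, (b i : Q F n 2) = expandMk F n (R i) := by
  let ε (i : ι) : Module.Dual F (reducedInvariants F n) :=
    (lcoeff F (δ i)).domRestrict (reducedInvariants F n)
  have hbases : Module.DualBases (fun i => (⟨R i, hR i⟩ : reducedInvariants F n)) ε :=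
    { eval_same := fun i => (hdual i i).trans (if_pos rfl)
      eval_of_ne := fun i j hij => (hdual i j).trans (if_neg hij)
      total := fun {S T} h => sub_eq_zero.1 <| Subtype.ext <| htotal _ (S - T).2 fun i => by
        rw [Submodule.coe_sub, coeff_sub, sub_eq_zero]
        exact h i }
  refine ⟨hbases.basis.map (reducedInvariantsEquiv F n), fun i => ?_⟩
  rw [Module.Basis.map_apply, coe_reducedInvariantsEquiv, hbases.coe_basis]

variable (F n) in
/-- The family of all `reducedY F n k` with `k ≤ q`, followed by the reduced polynomial of
`zPoly F n`. -/
noncomputable def reducedGenerator : Fin (q + 1) ⊕ Unit → MvPolynomial (Fin n) F :=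
  Sum.elim (fun k => reducedY F n k) fun _ => monomial (topExponent F n) 1

variable (F) in
/-- For each polynomial of `reducedGenerator F n`, the exponent of a monomial which occurs in it but
in no other member of the family. The variable `x_a` is singled out. -/
noncomputable def generatorExponent (a : Fin n) : Fin (q + 1) ⊕ Unit → Fin n →₀ ℕ :=
  Sum.elim (fun k => cornerExponent F a k) fun _ => topExponent F n

theorem reducedGenerator_mem_reducedInvariants (s : Fin (q + 1) ⊕ Unit) :
    reducedGenerator F n s ∈ reducedInvariants F n := by
  cases s with
  | inl k => exact reducedY_mem_reducedInvariants k
  | inr _ => exact monomial_topExponent_mem_reducedInvariants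

theorem isHomogeneous_reducedGenerator (a : Fin n) (s : Fin (q + 1) ⊕ Unit) :
    (reducedGenerator F n s).IsHomogeneous (generatorExponent F a s).degree := by
  cases s with
  | inl k =>
    rw [generatorExponent, Sum.elim_inl, degree_cornerExponent]
    exact isHomogeneous_reducedY k
  | inr _ => exact isHomogeneous_monomial _ rfl

theorem coeff_generatorExponent_reducedGenerator (a : Fin n) (s t : Fin (q + 1) ⊕ Unit) :
    coeff (generatorExponent F a s) (reducedGenerator F n t) = if s = t then 1 else 0 := by
  have hne (k : Fin (q + 1)) : topExponent F n ≠ cornerExponent F a k := fun h => by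
    have htop : q + 1 = cornerExponent F a k a := DFunLike.congr_fun h a
    exact (htop.trans_le (cornerExponent_apply_le a (Nat.le_of_lt_succ k.isLt) a)).not_gt
      (Nat.lt_succ_self _)
  rcases s with k | u <;> rcases t with l | u' <;>
    simp only [generatorExponent, reducedGenerator, Sum.elim_inl, Sum.elim_inr, coeff_reducedY,
      coeff_monomial, if_true]
  · refine if_congr ?_ rfl rfl
    rw [degree_cornerExponent, Nat.add_left_cancel_iff, Sum.inl.injEq, Fin.ext_iff]
    exact and_iff_right (cornerExponent_apply_le a (Nat.le_of_lt_succ k.isLt))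
  · rw [if_neg (hne k), if_neg Sum.inl_ne_inr]
  · rw [if_neg fun h => Nat.not_succ_le_self _ (h.1 a), if_neg Sum.inr_ne_inl]

theorem eq_zero_of_coeff_generatorExponent_eq_zero (a : Fin n) {R : MvPolynomial (Fin n) F}
    (hR : R ∈ reducedInvariants F n) (h0 : coeff 0 R = 0)
    (h : ∀ s, coeff (generatorExponent F a s) R = 0) : R = 0 :=
  eq_zero_of_coeff_eq_zero hR a h0 (fun k hk => h (Sum.inl ⟨k, Nat.lt_succ_of_le hk⟩))
    (h (Sum.inr ()))

theorem expandMk_reducedGenerator_inl (k : Fin (q + 1)) :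
    expandMk F n (reducedGenerator F n (Sum.inl k)) = Ideal.Quotient.mk _ (yPoly F n k) := by
  rw [expandMk_apply, reducedGenerator, Sum.elim_inl, expand_reducedY]

theorem expandMk_reducedGenerator_inr (u : Unit) :
    expandMk F n (reducedGenerator F n (Sum.inr u)) = Ideal.Quotient.mk _ (zPoly F n) := by
  rw [expandMk_apply, reducedGenerator, Sum.elim_inr, expand_monomial_topExponent]

variable (F) in
theorem exists_basis_of_eq_one :
    ∃ b : Module.Basis (Fin (q + 1) ⊕ Unit) F (invariants F 1 2),
      ∀ s, (b s : Q F 1 2) = expandMk F 1 (reducedGenerator F 1 s) := by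
  refine exists_basis_of_coeff_eq_ite reducedGenerator_mem_reducedInvariants
    (coeff_generatorExponent_reducedGenerator 0) fun R hR h =>
      eq_zero_of_coeff_generatorExponent_eq_zero 0 hR ?_ h
  have hcorner : cornerExponent F (0 : Fin 1) 0 = 0 :=
    (Finsupp.degree_eq_zero_iff _).1 (by
      rw [degree_cornerExponent, Nat.sub_self, zero_mul, zero_add])
  exact hcorner ▸ h (Sum.inl 0)

variable (F) in
theorem exists_basis_of_two_le (hn : 2 ≤ n) :
    ∃ b : Module.Basis (Unit ⊕ Fin (q + 1) ⊕ Unit) F (invariants F n 2),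
      (b (Sum.inl ()) : Q F n 2) = 1 ∧
      ∀ s, (b (Sum.inr s) : Q F n 2) = expandMk F n (reducedGenerator F n s) := by
  let a : Fin n := ⟨0, by omega⟩
  have hdeg (s) : (generatorExponent F a s).degree ≠ 0 := by
    have hpos : 0 < (n - 1) * q := Nat.mul_pos (by omega) Fintype.card_pos
    cases s with
    | inl k => exact (degree_cornerExponent a (k : ℕ)).trans_ne (by omega)
    | inr _ =>
      exact fun h => absurd (DFunLike.congr_fun ((Finsupp.degree_eq_zero_iff _).1 h) a)
        (Nat.succ_ne_zero _)
  obtain ⟨b, hb⟩ := exists_basis_of_coeff_eq_ite (ι := Unit ⊕ Fin (q + 1) ⊕ Unit)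
    (R := Sum.elim (fun _ => 1) (reducedGenerator F n))
    (δ := Sum.elim (fun _ => 0) (generatorExponent F a))
    (Sum.rec (fun _ => one_mem_reducedInvariants) reducedGenerator_mem_reducedInvariants) (by
      rintro (⟨⟩ | s) (⟨⟩ | t)
      · exact coeff_zero_one.trans (if_pos rfl).symm
      · refine ((isHomogeneous_reducedGenerator a t).coeff_eq_zero ?_).trans
          (if_neg Sum.inl_ne_inr).symm
        exact (map_zero Finsupp.degree).trans_ne (hdeg t).symm
      · exact (isHomogeneous_one (Fin n) F).coeff_eq_zero (hdeg s) |>.trans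
          (if_neg Sum.inr_ne_inl).symm
      · exact (coeff_generatorExponent_reducedGenerator a s t).trans
          (if_congr Sum.inr_injective.eq_iff.symm rfl rfl))
    fun R hR h => eq_zero_of_coeff_generatorExponent_eq_zero a hR (h (Sum.inl ()))
      fun s => h (Sum.inr s)
  exact ⟨b, (hb _).trans (map_one _), fun s => hb _⟩

theorem yPoly_one_zero : yPoly F 1 0 = 1 := by
  rw [← expand_reducedY, ← map_one (expand (q - 1))]
  congr 1
  ext i
  rw [coeff_reducedY, coeff_one, Nat.sub_self, zero_mul, zero_add]
  refine if_congr ⟨fun h => ((Finsupp.degree_eq_zero_iff _).1 h.2).symm, ?_⟩ rfl rfl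
  rintro rfl
  exact ⟨fun _ => Nat.zero_le _, map_zero _⟩

end Basis

section Series

open PowerSeries

theorem one_sub_X_pow_mul_inv {K : Type*} [Field K] {d : ℕ} (hd : d ≠ 0) :
    (1 - X ^ d : PowerSeries K) * (1 - X ^ d)⁻¹ = 1 :=
  PowerSeries.mul_inv_cancel _ (by simp [hd])

theorem sum_X_pow_mul_eq {K : Type*} [Field K] {d : ℕ} (hd : d ≠ 0) (N : ℕ) :
    ∑ k ∈ Finset.range N, (X : PowerSeries K) ^ (k * d) =
      (1 - X ^ (N * d)) * (1 - X ^ d)⁻¹ := by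
  have hgeom := geom_sum_mul_neg ((X : PowerSeries K) ^ d) N
  simp only [← pow_mul, mul_comm d] at hgeom
  rw [← hgeom, mul_assoc, one_sub_X_pow_mul_inv hd, mul_one]

theorem sq_sub_one_eq_mul (q : ℕ) : q ^ 2 - 1 = (q + 1) * (q - 1) := by
  rw [← Nat.sq_sub_sq, one_pow]

theorem sum_X_pow_mul_sub_one_range_add_one {q : ℕ} (hq : 1 < q) :
    ∑ k ∈ Finset.range (q + 1), (X : PowerSeries ℚ) ^ (k * (q - 1)) =
      (1 - X ^ (q ^ 2 - 1)) * (1 - X ^ (q - 1))⁻¹ := by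
  rw [sum_X_pow_mul_eq (Nat.sub_ne_zero_of_lt hq), sq_sub_one_eq_mul]

theorem sum_X_pow_mul_sub_one_range_add_two {q : ℕ} (hq : 1 < q) :
    ∑ k ∈ Finset.range (q + 2), (X : PowerSeries ℚ) ^ (k * (q - 1)) =
      (1 - X ^ (q ^ 2 + q - 2)) * (1 - X ^ (q - 1))⁻¹ := by
  have hdeg : (q + 2) * (q - 1) = q ^ 2 + q - 2 := by
    rw [Nat.succ_mul, ← sq_sub_one_eq_mul]
    have := Nat.one_le_pow 2 q hq.le
    omega
  rw [sum_X_pow_mul_eq (Nat.sub_ne_zero_of_lt hq), hdeg]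

theorem lrsSeries_one_two {q : ℕ} (hq : 1 < q) :
    lrsSeries q 1 2 = ∑ k ∈ Finset.range (q + 2), X ^ (k * (q - 1)) := by
  rw [Finset.sum_range_succ, ← sq_sub_one_eq_mul, sum_X_pow_mul_sub_one_range_add_one hq,
    add_comm]
  simp [lrsSeries, qtBinom, Finset.sum_range_succ]

theorem lrsSeries_two {q n : ℕ} (hq : 1 < q) (hn : 2 ≤ n) :
    lrsSeries q n 2 =
      1 + X ^ ((n - 1) * (q ^ 2 - q)) * (∑ k ∈ Finset.range (q + 1), X ^ (k * (q - 1))) +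
        X ^ (n * (q ^ 2 - 1)) := by
  have hsq : q * 2 ≤ q ^ 2 := by rw [pow_two]; exact Nat.mul_le_mul_left _ hq
  rw [lrsSeries, min_eq_right hn, sum_X_pow_mul_sub_one_range_add_one hq]
  simp only [qtBinom, Finset.sum_range_succ, Finset.prod_range_succ, Finset.range_zero,
    Finset.sum_empty, Finset.prod_empty, pow_zero, pow_one, Nat.sub_self, mul_zero, zero_add,
    one_mul, mul_one, Nat.sub_zero]
  rw [one_sub_X_pow_mul_inv (by omega), one_sub_X_pow_mul_inv (by omega), mul_one]
  ring

variable {F : Type*} [Fintype F] {n : ℕ}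

local notation "q" => Fintype.card F

theorem sum_X_pow_degree_generatorExponent (a : Fin n) :
    ∑ s, (X : PowerSeries ℚ) ^ ((q - 1) * (generatorExponent F a s).degree) =
      X ^ ((n - 1) * (q ^ 2 - q)) * (∑ k ∈ Finset.range (q + 1), X ^ (k * (q - 1))) +
        X ^ (n * (q ^ 2 - 1)) := by
  have htop : (topExponent F n).degree = n * (q + 1) := by
    simp [Finsupp.degree_eq_sum, topExponent]
  simp only [Fintype.sum_sum_type, generatorExponent, Sum.elim_inl, Sum.elim_inr,
    degree_cornerExponent, htop, Finset.univ_unique, Finset.sum_singleton]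
  rw [Finset.sum_range, Finset.mul_sum, sq_sub_one_eq_mul, mul_comm (q - 1), mul_assoc]
  refine congrArg (· + _) (Finset.sum_congr rfl fun k _ => ?_)
  rw [← pow_add, pow_two, ← Nat.mul_sub_one, mul_comm (q - 1), add_mul, mul_assoc]

variable [Field F]

variable (F) in
theorem hilbertSeries_one_two :
    hilbertSeries F 1 2 = ∑ k ∈ Finset.range (q + 2), X ^ (k * (q - 1)) := by
  obtain ⟨b, hb⟩ := exists_basis_of_eq_one F
  rw [hilbertSeries_eq_sum_of_basis b fun s => hb s ▸
      expandMk_mem_degreePart (isHomogeneous_reducedGenerator 0 s),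
    sum_X_pow_degree_generatorExponent, Nat.sub_self, zero_mul, pow_zero, one_mul, one_mul,
    sq_sub_one_eq_mul, ← Finset.sum_range_succ]

variable (F) in
theorem hilbertSeries_two_of_two_le (hn : 2 ≤ n) :
    hilbertSeries F n 2 =
      1 + X ^ ((n - 1) * (q ^ 2 - q)) * (∑ k ∈ Finset.range (q + 1), X ^ (k * (q - 1))) +
        X ^ (n * (q ^ 2 - 1)) := by
  let a : Fin n := ⟨0, by omega⟩
  obtain ⟨b, hb1, hb⟩ := exists_basis_of_two_le F hn
  let D := Sum.elim (fun _ : Unit => 0) fun s => (q - 1) * (generatorExponent F a s).degree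
  have hD (s) : (b s : Q F n 2) ∈ degreePart F n 2 (D s) := by
    rcases s with ⟨⟩ | s
    · exact hb1 ▸ map_one (expandMk F n) ▸
        expandMk_mem_degreePart (MvPolynomial.isHomogeneous_one (Fin n) F)
    · exact hb s ▸ expandMk_mem_degreePart (isHomogeneous_reducedGenerator a s)
  rw [hilbertSeries_eq_sum_of_basis b hD, Fintype.sum_sum_type]
  simp only [D, Sum.elim_inl, Sum.elim_inr, sum_X_pow_degree_generatorExponent,
    Finset.univ_unique, Finset.sum_singleton, pow_zero, add_assoc]

end Series

end FrobInv

open FrobInv in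
theorem mainTheorem1 (F : Type*) [Field F] [Fintype F] (q : ℕ) (hq : Fintype.card F = q)
    (n : ℕ) :
    (2 ≤ n →
      hilbertSeries F n 2 =
          1 + PowerSeries.X ^ ((n - 1) * (q ^ 2 - q)) *
              (∑ k ∈ Finset.range (q + 1), PowerSeries.X ^ (k * (q - 1)))
            + PowerSeries.X ^ (n * (q ^ 2 - 1)) ∧
      ∃ b : Module.Basis (Unit ⊕ Fin (q + 1) ⊕ Unit) F (invariants F n 2),
        (b (Sum.inl ()) : Q F n 2) = 1 ∧
        (∀ k : Fin (q + 1),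
          (b (Sum.inr (Sum.inl k)) : Q F n 2) = Ideal.Quotient.mk _ (yPoly F n k)) ∧
        (b (Sum.inr (Sum.inr ())) : Q F n 2) = Ideal.Quotient.mk _ (zPoly F n)) ∧
    (n = 1 →
      hilbertSeries F n 2 =
          (1 - PowerSeries.X ^ (q ^ 2 + q - 2)) * (1 - PowerSeries.X ^ (q - 1))⁻¹ ∧
      ∃ b : Module.Basis (Fin (q + 1) ⊕ Unit) F (invariants F n 2),
        (b (Sum.inl 0) : Q F n 2) = 1 ∧
        (∀ k : Fin (q + 1),
          (b (Sum.inl k) : Q F n 2) = Ideal.Quotient.mk _ (yPoly F n k)) ∧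
        (b (Sum.inr ()) : Q F n 2) = Ideal.Quotient.mk _ (zPoly F n)) ∧
    (1 ≤ n → hilbertSeries F n 2 = lrsSeries q n 2) := by
  subst hq
  have hq : 1 < Fintype.card F := Fintype.one_lt_card
  refine ⟨fun hn => ⟨hilbertSeries_two_of_two_le F hn, ?_⟩, fun hn => ?_, fun hn => ?_⟩
  · obtain ⟨b, hb1, hb⟩ := exists_basis_of_two_le F hn
    exact ⟨b, hb1, fun k => (hb _).trans (expandMk_reducedGenerator_inl k),
      (hb _).trans (expandMk_reducedGenerator_inr ())⟩
  · subst hn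
    obtain ⟨b, hb⟩ := exists_basis_of_eq_one F
    have hy (k : Fin (Fintype.card F + 1)) := (hb _).trans (expandMk_reducedGenerator_inl k)
    refine ⟨?_, b, ?_, hy, (hb _).trans (expandMk_reducedGenerator_inr ())⟩
    · rw [hilbertSeries_one_two, sum_X_pow_mul_sub_one_range_add_two hq]
    · exact (hy 0).trans (by rw [Fin.val_zero, yPoly_one_zero, map_one])
  · rcases hn.eq_or_lt with rfl | hn
    · rw [hilbertSeries_one_two, lrsSeries_one_two hq]
    · rw [hilbertSeries_two_of_two_le F hn, lrsSeries_two hq hn]
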